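/- A permutation $\pi$ of $\{1,\dots,n\}$ contains a permutation $\sigma$ of $\{1,\dots,k\}$ as a pattern if there are positions $i_1<\dots<i_k$ such that $\pi(i_1),\dots,\pi(i_k)$ are in the same relative order as $\sigma(1),\dots,\sigma(k)$; otherwise $\pi$ avoids $\sigma$. Let $\operatorname{Av}(2143,4312)$ be the class of all permutations (of all lengths $n\ge 0$, including the empty permutation) that avoid both $2143$ and $4312$, and let $a_n$ be the number of permutations of length $n$ in this class. Then the generating function $f(x)=\sum_{n\ge 0}a_nx^n$ of the class is rational, and $$f(x)=\frac{1-16x+109x^2-411x^3+936x^4-1323x^5+1154x^6-602x^7+178x^8-28x^9}{(1-x)^2(1-3x)^2(1-3x+x^2)^3}$$ as formal power series. -/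

import Mathlib

/-- The permutation `π` of length `n` contains the permutation `σ` of length `k` as a pattern:
some subsequence of `π` (at the positions `f 0 < f 1 < ⋯`) is order isomorphic to `σ`. -/
def PermContains {n k : ℕ} (π : Equiv.Perm (Fin n)) (σ : Equiv.Perm (Fin k)) : Prop :=
  ∃ f : Fin k ↪o Fin n, ∀ i j : Fin k, σ i < σ j ↔ π (f i) < π (f j)

/-- `Av B`: the class of all permutations, of every length (the empty permutation included),
that contain no permutation of `B` as a pattern. -/
def Av (B : Set (Σ k : ℕ, Equiv.Perm (Fin k))) : Set (Σ n : ℕ, Equiv.Perm (Fin n)) :=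
  {π | ∀ σ ∈ B, ¬ PermContains π.2 σ.2}

/-- The ordinary generating function of a set of permutations: the coefficient of `x ^ n` is
the number of its members of length `n`. -/
noncomputable def permGenFun (C : Set (Σ n : ℕ, Equiv.Perm (Fin n))) : PowerSeries ℚ :=
  PowerSeries.mk fun n =>
    (Nat.card {π : Equiv.Perm (Fin n) // (⟨n, π⟩ : Σ n : ℕ, Equiv.Perm (Fin n)) ∈ C} : ℚ)

/-- The permutation with one-line notation 2143 (positions and values are counted from 0). -/
def perm2143 : Equiv.Perm (Fin 4) where
  toFun := ![1, 0, 3, 2]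
  invFun := ![1, 0, 3, 2]
  left_inv := by decide
  right_inv := by decide

/-- The permutation with one-line notation 4312 (positions and values are counted from 0). -/
def perm4312 : Equiv.Perm (Fin 4) where
  toFun := ![3, 2, 0, 1]
  invFun := ![2, 3, 1, 0]
  left_inv := by decide
  right_inv := by decide

/-! The class is a generating tree: each nonempty avoider arises exactly once from a shorter one by
inserting a new maximum at an active site. A new maximum can only play the 4 of a forbidden pattern,
so a site is active when no 21 before it is exceeded by an entry after it and no 312 follows it.
Inserting at `p` does not change the activity of sites to the right; a site `q` to the left stays
active only if the entries before `q` increase and those from `p` on decrease (`act_insMax_of_le`).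
Hence it suffices to count active sites with increasing prefix (i), with decreasing suffix (d), and
with neither (m).

If no site is of both of the first two kinds, the subtree depends only on the triple, through (i, m,
d) → (1, m + j, d) for j < i, (0, j + 1, d) for j < m, (i, 0, j + 1) for j < d. Nonempty
permutations having a site of both kinds are unimodal; with a entries before the maximum and b after
it, (a, b) → (a, b + 1), (a + 1, b), (1, j, b + 2) for j < a, (a + 2, 0, j + 1) for j < b.

The generating function of a subtree is 1 plus x times the sum over the children. The factor x makes
these equations determine all coefficients recursively, so exhibiting solutions is enough:
`countsSeries_eq` and `unimodalSeries_eq`. The root `[0]` has a = b = 0, so the class has generating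
function 1 + x U(0, 0), which is then simplified. -/

open scoped List

/-! ### Inserting a new maximum into a split list -/

/-- The list `l` contains no subsequence ordered like 2143 or like 4312. -/
def ListAvoids (l : List ℕ) : Prop :=
  ∀ a b c d, a < b → b < c → c < d → ¬ [b, a, d, c] <+ l ∧ ¬ [d, c, a, b] <+ l

/-- A new maximum may be inserted between `A` and `B` without creating 2143 or 4312. -/
def ActiveSplit (A B : List ℕ) : Prop :=
  (∀ a b c, a < b → b < c → [b, a] <+ A → c ∉ B) ∧
    ∀ a b c, a < b → b < c → ¬ [c, a, b] <+ B

theorem sublist_append_of_notMem {α : Type*} {N : α} {s A B : List α}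
    (h : s <+ A ++ N :: B) (hN : N ∉ s) : s <+ A ++ B := by
  obtain ⟨s₁, s₂, rfl, h₁, h₂⟩ := List.sublist_append_iff.1 h
  refine h₁.append ?_
  rcases List.sublist_cons_iff.1 h₂ with h | ⟨r, rfl, _⟩
  · exact h
  · simp at hN

theorem sublist_split_of_notMem {α : Type*} {N : α} {s r A B : List α}
    (h : s ++ N :: r <+ A ++ N :: B) (hA : N ∉ A) (hB : N ∉ B) : s <+ A ∧ r <+ B := by
  obtain ⟨s₁, s₂, hs, h₁, h₂⟩ := List.sublist_append_iff.1 h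
  have hN₁ : N ∉ s₁ := fun h => hA (h₁.subset h)
  rcases List.sublist_cons_iff.1 h₂ with h | ⟨r', rfl, h'⟩
  · have : N ∈ s₁ ++ s₂ := hs ▸ by simp
    rcases List.mem_append.1 this with h'' | h''
    · exact absurd h'' hN₁
    · exact absurd (h.subset h'') hB
  · rcases List.append_eq_append_iff.1 hs with ⟨t, h1, h2⟩ | ⟨t, h1, h2⟩
    · rcases t with _ | ⟨x, t⟩
      · simp at h1 h2
        subst h1 h2
        exact ⟨h₁, h'⟩
      · simp only [List.cons_append, List.cons.injEq] at h2
        exact absurd (by rw [h1, ← h2.1]; simp) hN₁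
    · rcases t with _ | ⟨x, t⟩
      · simp at h1 h2
        subst h1 h2
        exact ⟨h₁, h'⟩
      · simp only [List.cons_append, List.cons.injEq] at h2
        exact absurd (h'.subset (by rw [h2.2]; simp)) hB

/-- An occurrence using `N` must use it as its 4: in 2143 it has a 21 before it and the 3 after it,
in 4312 it is followed by a 312. These are the two clauses of `ActiveSplit`. -/
theorem listAvoids_insert_iff {N : ℕ} {A B : List ℕ} (hA : ∀ x ∈ A, x < N) (hB : ∀ x ∈ B, x < N) :
    ListAvoids (A ++ N :: B) ↔ ListAvoids (A ++ B) ∧ ActiveSplit A B := by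
  have hNA : N ∉ A := fun h => (hA _ h).false
  have hNB : N ∉ B := fun h => (hB _ h).false
  have hsub : A ++ B <+ A ++ N :: B := (List.Sublist.refl A).append (List.sublist_cons_self N B)
  constructor
  · refine fun h => ⟨fun a b c d hab hbc hcd => ?_, fun a b c hab hbc hl hc => ?_,
      fun a b c hab hbc hl => ?_⟩
    · exact ⟨fun h' => (h a b c d hab hbc hcd).1 (h'.trans hsub),
        fun h' => (h a b c d hab hbc hcd).2 (h'.trans hsub)⟩
    · exact (h a b c N hab hbc (hB _ hc)).1
        (hl.append ((List.singleton_sublist.2 hc).cons_cons N))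
    · have hcB : c ∈ B := hl.subset (by simp)
      exact (h a b c N hab hbc (hB _ hcB)).2 ((hl.cons_cons N).trans (List.sublist_append_right A _))
  · rintro ⟨h, h1, h2⟩ a b c d hab hbc hcd
    have hlt : ∀ x, x ∈ A ++ N :: B → x ≤ N := fun x hx => by
      rcases List.mem_append.1 hx with hx | hx
      · exact (hA _ hx).le
      · rcases List.mem_cons.1 hx with hx | hx
        · exact hx.le
        · exact (hB _ hx).le
    constructor
    · intro hs
      have hd := hlt d (hs.subset (by simp))
      by_cases hdN : d = N
      · subst hdN
        have := sublist_split_of_notMem (s := [b, a]) (r := [c]) hs hNA hNB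
        exact h1 a b c hab hbc this.1 (List.singleton_sublist.1 this.2)
      · exact (h a b c d hab hbc hcd).1 (sublist_append_of_notMem hs (by simp; omega))
    · intro hs
      have hd := hlt d (hs.subset (by simp))
      by_cases hdN : d = N
      · subst hdN
        have := sublist_split_of_notMem (s := []) (r := [c, a, b]) hs hNA hNB
        exact h2 a b c hab hbc this.2
      · exact (h a b c d hab hbc hcd).2 (sublist_append_of_notMem hs (by simp; omega))

/-- A maximum in the prefix cannot take part in a 21 that lies below an entry of `C`, so it creates
no obstruction. -/
theorem activeSplit_insert_left {N : ℕ} {A B C : List ℕ} (hC : ∀ x ∈ C, x < N) :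
    ActiveSplit (A ++ N :: B) C ↔ ActiveSplit (A ++ B) C := by
  have hsub : A ++ B <+ A ++ N :: B := (List.Sublist.refl A).append (List.sublist_cons_self N B)
  refine and_congr_left fun _ => ⟨fun h a b c hab hbc hl => h a b c hab hbc (hl.trans hsub),
    fun h a b c hab hbc hl hc => ?_⟩
  have := hC c hc
  exact h a b c hab hbc (sublist_append_of_notMem hl (by simp; omega)) hc

/-- A maximum in the suffix exceeds every descent of `A`, and forms a 312 with every ascent of `C`;
so neither may exist. Weak inequalities are the exact negations of these, and no distinctness of
entries is needed. -/
theorem activeSplit_insert_right {N : ℕ} {A B C : List ℕ} (hA : ∀ x ∈ A, x < N)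
    (hB : ∀ x ∈ B, x < N) (hC : ∀ x ∈ C, x < N) :
    ActiveSplit A (B ++ N :: C) ↔
      A.Pairwise (· ≤ ·) ∧ C.Pairwise (· ≥ ·) ∧ ActiveSplit A (B ++ C) := by
  have hNB : N ∉ B := fun h => (hB _ h).false
  have hNC : N ∉ C := fun h => (hC _ h).false
  have hsub : B ++ C <+ B ++ N :: C := (List.Sublist.refl B).append (List.sublist_cons_self N C)
  constructor
  · rintro ⟨h1, h2⟩
    refine ⟨List.pairwise_iff_forall_sublist.2 fun {b a} hl => ?_,
      List.pairwise_iff_forall_sublist.2 fun {a b} hl => ?_,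
      fun a b c hab hbc hl hc => h1 a b c hab hbc hl (hsub.subset hc),
      fun a b c hab hbc hl => h2 a b c hab hbc (hl.trans hsub)⟩
    · by_contra hab
      exact h1 a b N (not_le.1 hab) (hA _ (hl.subset (by simp))) hl (by simp)
    · by_contra hab
      exact h2 a b N (not_le.1 hab) (hC _ (hl.subset (by simp)))
        ((hl.cons_cons N).trans (List.sublist_append_right B _))
  · rintro ⟨hi, hd, h1, h2⟩
    refine ⟨fun a b c hab hbc hl => ?_, fun a b c hab hbc hl => ?_⟩
    · have := List.pairwise_iff_forall_sublist.1 hi hl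
      omega
    · by_cases hcN : c = N
      · subst hcN
        have := List.pairwise_iff_forall_sublist.1 hd
          (sublist_split_of_notMem (s := []) (r := [a, b]) hl hNB hNC).2
        omega
      · have hcN' : c ≤ N := by
          have : c ∈ B ++ N :: C := hl.subset (by simp)
          rcases List.mem_append.1 this with hx | hx
          · exact (hB _ hx).le
          · rcases List.mem_cons.1 hx with hx | hx
            · exact hx.le
            · exact (hC _ hx).le
        exact h2 a b c hab hbc (sublist_append_of_notMem hl (by simp; omega))

theorem pairwise_le_insert_iff {N : ℕ} {A B : List ℕ} (hA : ∀ x ∈ A, x < N)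
    (hB : ∀ x ∈ B, x < N) :
    (A ++ N :: B).Pairwise (· ≤ ·) ↔ B = [] ∧ A.Pairwise (· ≤ ·) := by
  constructor
  · intro h
    rw [List.pairwise_append, List.pairwise_cons] at h
    refine ⟨List.eq_nil_iff_forall_not_mem.2 fun x hx => ?_, h.1⟩
    exact absurd (h.2.1.1 x hx) (not_le.2 (hB x hx))
  · rintro ⟨rfl, h⟩
    rw [List.pairwise_append]
    exact ⟨h, by simp, fun x hx y hy => by simp at hy; exact hy ▸ (hA x hx).le⟩

theorem pairwise_ge_insert_iff {N : ℕ} {A B : List ℕ} (hA : ∀ x ∈ A, x < N)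
    (hB : ∀ x ∈ B, x < N) :
    (A ++ N :: B).Pairwise (· ≥ ·) ↔ A = [] ∧ B.Pairwise (· ≥ ·) := by
  constructor
  · intro h
    rw [List.pairwise_append, List.pairwise_cons] at h
    refine ⟨List.eq_nil_iff_forall_not_mem.2 fun x hx => ?_, h.2.1.2⟩
    exact absurd (h.2.2 x hx N (by simp)) (not_le.2 (hA x hx))
  · rintro ⟨rfl, h⟩
    exact List.pairwise_cons.2 ⟨fun x hx => (hB x hx).le, h⟩

/-! ### Sites of a list and their change under insertion -/

/-- Insert the new maximum `l.length` at position `p`. -/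
def insMax (l : List ℕ) (p : ℕ) : List ℕ := l.take p ++ l.length :: l.drop p

/-- Position `p` of `l` is an active site. -/
def Act (l : List ℕ) (p : ℕ) : Prop := ActiveSplit (l.take p) (l.drop p)

/-- The entries of `l` before position `p` increase. -/
def IncAt (l : List ℕ) (p : ℕ) : Prop := (l.take p).Pairwise (· ≤ ·)

/-- The entries of `l` from position `p` on decrease. -/
def DecAt (l : List ℕ) (p : ℕ) : Prop := (l.drop p).Pairwise (· ≥ ·)

/-- Every entry of `l` is smaller than its length. -/
def Bounded (l : List ℕ) : Prop := ∀ x ∈ l, x < l.length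

theorem IncAt.mono {l : List ℕ} {p q : ℕ} (h : IncAt l q) (hpq : p ≤ q) : IncAt l p :=
  by
  rw [IncAt, ← min_eq_left hpq, ← List.take_take]
  exact h.sublist (List.take_sublist _ _)

theorem DecAt.mono {l : List ℕ} {p q : ℕ} (h : DecAt l p) (hpq : p ≤ q) : DecAt l q :=
  h.sublist (List.drop_suffix_drop_left l hpq).sublist

@[simp] theorem length_insMax (l : List ℕ) (p : ℕ) : (insMax l p).length = l.length + 1 := by
  simp [insMax]; omega

theorem Bounded.insMax {l : List ℕ} (h : Bounded l) (p : ℕ) : Bounded (insMax l p) := by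
  intro x hx
  rw [length_insMax]
  rcases List.mem_append.1 hx with hx | hx
  · exact (h x (List.mem_of_mem_take hx)).trans (Nat.lt_succ_self _)
  · rcases List.mem_cons.1 hx with hx | hx
    · omega
    · exact (h x (List.mem_of_mem_drop hx)).trans (Nat.lt_succ_self _)

theorem take_insMax_of_le {l : List ℕ} {p q : ℕ} (hqp : q ≤ p) (hp : p ≤ l.length) :
    (insMax l p).take q = l.take q := by
  rw [insMax, List.take_append_of_le_length (by simp; omega), List.take_take, min_eq_left hqp]

theorem drop_insMax_of_le {l : List ℕ} {p q : ℕ} (hqp : q ≤ p) (hp : p ≤ l.length) :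
    (insMax l p).drop q = (l.take p).drop q ++ l.length :: l.drop p := by
  rw [insMax, List.drop_append_of_le_length (by simp; omega)]

theorem take_insMax_succ {l : List ℕ} {p q : ℕ} (hpq : p ≤ q) (hp : p ≤ l.length) :
    (insMax l p).take (q + 1) = l.take p ++ l.length :: (l.drop p).take (q - p) := by
  rw [insMax, List.take_append, List.take_of_length_le (by simp; omega)]
  have : q + 1 - (l.take p).length = (q - p) + 1 := by simp; omega
  rw [this, List.take_succ_cons]

theorem drop_insMax_succ {l : List ℕ} {p q : ℕ} (hpq : p ≤ q) (hp : p ≤ l.length) :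
    (insMax l p).drop (q + 1) = l.drop q := by
  rw [insMax, List.drop_append, List.drop_eq_nil_of_le (by simp; omega)]
  have : q + 1 - (l.take p).length = (q - p) + 1 := by simp; omega
  rw [this, List.drop_succ_cons, List.drop_drop, List.nil_append]
  congr 1; omega

theorem take_append_take_drop {l : List ℕ} {p q : ℕ} (hpq : p ≤ q) :
    l.take p ++ (l.drop p).take (q - p) = l.take q := by
  rw [← List.take_add]; congr 1; omega

theorem drop_take_append_drop {l : List ℕ} {p q : ℕ} (hqp : q ≤ p) :
    (l.take p).drop q ++ l.drop p = l.drop q := by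
  have : l.drop p = (l.drop q).drop (p - q) := by rw [List.drop_drop]; congr 1; omega
  rw [List.drop_take, this, List.take_append_drop]

theorem act_insMax_succ {l : List ℕ} {p q : ℕ} (hl : Bounded l) (hp : p ≤ l.length) (hpq : p ≤ q) :
    Act (insMax l p) (q + 1) ↔ Act l q := by
  rw [Act, take_insMax_succ hpq hp, drop_insMax_succ hpq hp,
    activeSplit_insert_left fun x hx => hl x (List.mem_of_mem_drop hx),
    take_append_take_drop hpq, Act]

theorem incAt_insMax_succ {l : List ℕ} {p q : ℕ} (hl : Bounded l) (hp : p ≤ l.length) (hpq : p ≤ q)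
    (hq : q ≤ l.length) : IncAt (insMax l p) (q + 1) ↔ q = p ∧ IncAt l p := by
  rw [IncAt, take_insMax_succ hpq hp, pairwise_le_insert_iff
    (fun x hx => hl x (List.mem_of_mem_take hx))
    (fun x hx => hl x (List.mem_of_mem_drop (List.mem_of_mem_take hx)))]
  refine and_congr_left fun _ => ?_
  rw [← List.length_eq_zero_iff, List.length_take, List.length_drop]
  omega

theorem decAt_insMax_succ {l : List ℕ} {p q : ℕ} (hp : p ≤ l.length) (hpq : p ≤ q) :
    DecAt (insMax l p) (q + 1) ↔ DecAt l q := by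
  rw [DecAt, drop_insMax_succ hpq hp, DecAt]

theorem act_insMax_of_le {l : List ℕ} {p q : ℕ} (hl : Bounded l) (hp : p ≤ l.length) (hqp : q ≤ p) :
    Act (insMax l p) q ↔ IncAt l q ∧ DecAt l p ∧ Act l q := by
  rw [Act, take_insMax_of_le hqp hp, drop_insMax_of_le hqp hp, activeSplit_insert_right
    (fun x hx => hl x (List.mem_of_mem_take hx))
    (fun x hx => hl x (List.mem_of_mem_take (List.mem_of_mem_drop hx)))
    (fun x hx => hl x (List.mem_of_mem_drop hx)), drop_take_append_drop hqp]
  rfl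

theorem incAt_insMax_of_le {l : List ℕ} {p q : ℕ} (hp : p ≤ l.length) (hqp : q ≤ p) :
    IncAt (insMax l p) q ↔ IncAt l q := by
  rw [IncAt, take_insMax_of_le hqp hp, IncAt]

theorem decAt_insMax_of_le {l : List ℕ} {p q : ℕ} (hl : Bounded l) (hp : p ≤ l.length)
    (hqp : q ≤ p) : DecAt (insMax l p) q ↔ q = p ∧ DecAt l p := by
  rw [DecAt, drop_insMax_of_le hqp hp, pairwise_ge_insert_iff
    (fun x hx => hl x (List.mem_of_mem_take (List.mem_of_mem_drop hx)))
    (fun x hx => hl x (List.mem_of_mem_drop hx))]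
  refine and_congr_left fun _ => ?_
  rw [← List.length_eq_zero_iff, List.length_drop, List.length_take]
  omega

theorem listAvoids_insMax_iff {l : List ℕ} {p : ℕ} (hl : Bounded l) :
    ListAvoids (insMax l p) ↔ ListAvoids l ∧ Act l p := by
  rw [insMax, listAvoids_insert_iff (fun x hx => hl x (List.mem_of_mem_take hx))
    (fun x hx => hl x (List.mem_of_mem_drop hx)), List.take_append_drop, Act]

/-! ### The succession rule away from unimodal lists -/

open scoped Classical in
/-- The number of ways to insert `k` successive new maxima at active sites, starting from `l`. -/
noncomputable def descendants : ℕ → List ℕ → ℕ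
  | 0, _ => 1
  | k + 1, l => ∑ p ∈ (Finset.range (l.length + 1)).filter (Act l), descendants k (insMax l p)

/-- A child's parameter is governed by the number of sites of the same kind right of the insertion
point; as the point varies over `S` this number takes each value below `S.card` once. -/
theorem Finset.sum_card_filter_gt {M : Type*} [AddCommMonoid M] (S : Finset ℕ) (φ : ℕ → M) :
    ∑ p ∈ S, φ (S.filter (p < ·)).card = ∑ j ∈ Finset.range S.card, φ j := by
  induction S using Finset.induction_on_min with
  | empty => simp
  | insert a s ha ih =>
    have has : a ∉ s := fun h => (ha a h).false
    rw [Finset.sum_insert has, Finset.card_insert_of_notMem has, Finset.sum_range_succ, add_comm,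
      ← ih]
    congr 1
    · refine Finset.sum_congr rfl fun p hp => ?_
      rw [Finset.filter_insert, if_neg (ha p hp).not_gt]
    · congr 2
      rw [Finset.filter_insert, if_neg (lt_irrefl a), Finset.filter_true_of_mem ha]

/-- Site `p` splits into the sites just before and just after the new maximum, so `q = p` is counted
in both summands. -/
theorem card_filter_range_insert {n p : ℕ} (hp : p ≤ n) (P : ℕ → Prop) [DecidablePred P] :
    ((Finset.range (n + 1 + 1)).filter P).card =
      ((Finset.range (n + 1)).filter fun q => q ≤ p ∧ P q).card +
        ((Finset.range (n + 1)).filter fun q => p ≤ q ∧ P (q + 1)).card := by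
  rw [← Finset.card_image_of_injective ((Finset.range (n + 1)).filter fun q => p ≤ q ∧ P (q + 1))
    (add_left_injective 1), ← Finset.card_union_of_disjoint]
  · congr 1
    ext q
    simp only [Finset.mem_filter, Finset.mem_range, Finset.mem_union, Finset.mem_image]
    constructor
    · rintro ⟨hq, h⟩
      rcases le_or_gt q p with hqp | hqp
      · exact Or.inl ⟨by omega, hqp, h⟩
      · refine Or.inr ⟨q - 1, ⟨by omega, by omega, ?_⟩, by omega⟩
        rwa [Nat.sub_add_cancel (by omega)]
    · rintro (h | ⟨r, ⟨hr, _, h⟩, rfl⟩)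
      · exact ⟨by omega, h.2.2⟩
      · exact ⟨by omega, h⟩
  · refine Finset.disjoint_left.2 fun q hq hq' => ?_
    simp only [Finset.mem_filter, Finset.mem_image] at hq hq'
    obtain ⟨r, hr, rfl⟩ := hq'
    omega

open scoped Classical in
/-- The site counts of a list with no site whose prefix increases while its suffix decreases:
`i` active sites with increasing prefix, `d` with decreasing suffix and `m` others. -/
structure SiteCounts (l : List ℕ) (i m d : ℕ) : Prop where
  bounded : Bounded l
  disjoint : ∀ q ≤ l.length, IncAt l q → ¬ DecAt l q
  card_inc : ((Finset.range (l.length + 1)).filter fun q => Act l q ∧ IncAt l q).card = i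
  card_mid : ((Finset.range (l.length + 1)).filter fun q =>
    Act l q ∧ ¬ IncAt l q ∧ ¬ DecAt l q).card = m
  card_dec : ((Finset.range (l.length + 1)).filter fun q => Act l q ∧ DecAt l q).card = d

/-- The list `l` increases to its maximum, which has `a` entries before it, and decreases to the
`b` entries after it. -/
structure Unimodal (l : List ℕ) (a b : ℕ) : Prop where
  bounded : Bounded l
  length_eq : l.length = a + b + 1
  act : ∀ q ≤ l.length, Act l q
  inc_iff : ∀ q ≤ l.length, IncAt l q ↔ q ≤ a + 1
  dec_iff : ∀ q ≤ l.length, DecAt l q ↔ a ≤ q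

/-- A site at or before the new maximum has decreasing suffix only when `q = p`, and one after it
has increasing prefix only when adjacent to it; either way `p` was already of both kinds. Thus a
branch that leaves the unimodal lists never returns. -/
theorem disjoint_insMax {l : List ℕ} {p : ℕ} (hl : Bounded l) (hp : p ≤ l.length)
    (h : ¬ (IncAt l p ∧ DecAt l p)) :
    ∀ q ≤ (insMax l p).length, IncAt (insMax l p) q → ¬ DecAt (insMax l p) q := by
  intro q hq hi hd
  rw [length_insMax] at hq
  rcases le_or_gt q p with hqp | hqp
  · rw [incAt_insMax_of_le hp hqp] at hi
    rw [decAt_insMax_of_le hl hp hqp] at hd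
    exact h ⟨hd.1 ▸ hi, hd.2⟩
  · obtain ⟨q, rfl⟩ : ∃ r, q = r + 1 := ⟨q - 1, by omega⟩
    rw [incAt_insMax_succ hl hp (by omega) (by omega)] at hi
    rw [decAt_insMax_succ hp (by omega)] at hd
    exact h ⟨hi.2, hi.1 ▸ hd⟩

open scoped Classical in
/-- Site counts after an insertion, in terms of the sites before it. -/
theorem siteCounts_insMax {l : List ℕ} {p i m d : ℕ} (hl : Bounded l) (hp : p ≤ l.length)
    (h : ¬ (IncAt l p ∧ DecAt l p))
    (hi : ((Finset.range (l.length + 1)).filter fun q =>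
        q ≤ p ∧ IncAt l q ∧ DecAt l p ∧ Act l q).card +
      ((Finset.range (l.length + 1)).filter fun q => q = p ∧ Act l q ∧ IncAt l q).card = i)
    (hm : ((Finset.range (l.length + 1)).filter fun q =>
      p ≤ q ∧ Act l q ∧ ¬ (q = p ∧ IncAt l q) ∧ ¬ DecAt l q).card = m)
    (hd : ((Finset.range (l.length + 1)).filter fun q => p ≤ q ∧ Act l q ∧ DecAt l q).card = d) :
    SiteCounts (insMax l p) i m d := by
  refine ⟨hl.insMax p, disjoint_insMax hl hp h, ?_, ?_, ?_⟩
  · rw [length_insMax, card_filter_range_insert hp, ← hi]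
    congr 2
    · refine Finset.filter_congr fun q _ => and_congr_right fun hq => ?_
      rw [act_insMax_of_le hl hp hq, incAt_insMax_of_le hp hq]
      tauto
    · refine Finset.filter_congr fun q hq' => ?_
      have : q ≤ l.length := by simpa [Nat.lt_succ_iff] using hq'
      constructor
      · rintro ⟨hq, h⟩
        rw [act_insMax_succ hl hp hq, incAt_insMax_succ hl hp hq this] at h
        exact ⟨h.2.1, h.1, h.2.1 ▸ h.2.2⟩
      · rintro ⟨rfl, h'⟩
        rw [act_insMax_succ hl hp le_rfl, incAt_insMax_succ hl hp le_rfl this]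
        exact ⟨le_rfl, h'.1, rfl, h'.2⟩
  · rw [length_insMax, card_filter_range_insert hp, ← hm, Finset.card_eq_zero.2, zero_add]
    · congr 1
      refine Finset.filter_congr fun q hq' => and_congr_right fun hq => ?_
      have : q ≤ l.length := by simpa [Nat.lt_succ_iff] using hq'
      rw [act_insMax_succ hl hp hq, incAt_insMax_succ hl hp hq this, decAt_insMax_succ hp hq]
      refine and_congr_right fun _ => and_congr_left fun _ => not_congr ?_
      exact ⟨fun h => ⟨h.1, h.1 ▸ h.2⟩, fun h => ⟨h.1, h.1 ▸ h.2⟩⟩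
    · refine Finset.filter_eq_empty_iff.2 fun q _ => ?_
      rintro ⟨hq, h⟩
      rw [act_insMax_of_le hl hp hq, incAt_insMax_of_le hp hq] at h
      exact h.2.1 h.1.1
  · rw [length_insMax, card_filter_range_insert hp, ← hd, Finset.card_eq_zero.2, zero_add]
    · congr 1
      refine Finset.filter_congr fun q hq' => and_congr_right fun hq => ?_
      rw [act_insMax_succ hl hp hq, decAt_insMax_succ hp hq]
    · refine Finset.filter_eq_empty_iff.2 fun q _ => ?_
      rintro ⟨hq, h'⟩
      rw [act_insMax_of_le hl hp hq, decAt_insMax_of_le hl hp hq] at h'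
      exact h ⟨h'.2.1 ▸ h'.1.1, h'.2.2⟩

open scoped Classical in
-- The suffix at `p` does not decrease, so all sites up to the new maximum die. The site just after
-- it is the only one with increasing prefix; the former such sites further right become middle
-- sites, and all decreasing sites lie to the right and survive.
theorem SiteCounts.insMax_inc {l : List ℕ} {i m d p : ℕ} (h : SiteCounts l i m d)
    (hp : p ≤ l.length) (ha : Act l p) (hi : IncAt l p) :
    SiteCounts (insMax l p) 1 (m + (((Finset.range (l.length + 1)).filter fun q =>
      Act l q ∧ IncAt l q).filter (p < ·)).card) d := by
  have hnd := h.disjoint p hp hi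
  have hlt : ∀ q, DecAt l q → p < q := fun q hq => by
    by_contra hqp
    exact hnd (hq.mono (not_lt.1 hqp))
  refine siteCounts_insMax h.bounded hp (fun h' => hnd h'.2) ?_ ?_ ?_
  · rw [Finset.card_eq_zero.2, zero_add, Finset.card_eq_one]
    · refine ⟨p, Finset.ext fun q => ?_⟩
      simp only [Finset.mem_filter, Finset.mem_range, Finset.mem_singleton]
      exact ⟨fun h => h.2.1, fun h => ⟨by omega, h, h ▸ ha, h ▸ hi⟩⟩
    · exact Finset.filter_eq_empty_iff.2 fun q _ h' => hnd h'.2.2.1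
  · rw [← h.card_mid, ← Finset.card_union_of_disjoint]
    · congr 1
      ext q
      simp only [Finset.mem_filter, Finset.mem_range, Finset.mem_union]
      have h1 : ¬ IncAt l q → p < q := fun hq => by
        by_contra hqp
        exact hq (hi.mono (not_lt.1 hqp))
      have h2 : q < l.length + 1 → IncAt l q → ¬ DecAt l q := fun hq => h.disjoint q (by omega)
      have h3 : p ≤ q ↔ p < q ∨ q = p := by omega
      have h4 : p < q → q ≠ p := by omega
      have h5 : q = p → IncAt l q := fun h => h ▸ hi
      tauto
    · refine Finset.disjoint_left.2 fun q hq hq' => ?_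
      simp only [Finset.mem_filter] at hq hq'
      tauto
  · rw [← h.card_dec]
    congr 1
    refine Finset.filter_congr fun q _ => ?_
    exact ⟨fun h => h.2, fun h => ⟨(hlt q h.2).le, h⟩⟩

open scoped Classical in
theorem card_filter_le_eq {S : Finset ℕ} {p : ℕ} (hp : p ∈ S) :
    (S.filter (p ≤ ·)).card = (S.filter (p < ·)).card + 1 := by
  have : S.filter (p ≤ ·) = insert p (S.filter (p < ·)) := by
    ext q
    simp only [Finset.mem_filter, Finset.mem_insert]
    constructor
    · rintro ⟨h1, h2⟩
      rcases h2.eq_or_lt with h | h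
      · exact Or.inl h.symm
      · exact Or.inr ⟨h1, h⟩
    · rintro (rfl | h)
      · exact ⟨hp, le_rfl⟩
      · exact ⟨h.1, h.2.le⟩
  rw [this, Finset.card_insert_of_notMem (by simp)]

open scoped Classical in
-- Everything up to the new maximum dies, including all increasing sites. The `+ 1` is the site just
-- after the new maximum.
theorem SiteCounts.insMax_mid {l : List ℕ} {i m d p : ℕ} (h : SiteCounts l i m d)
    (hp : p ≤ l.length) (ha : Act l p) (hi : ¬ IncAt l p) (hd : ¬ DecAt l p) :
    SiteCounts (insMax l p) 0 ((((Finset.range (l.length + 1)).filter fun q =>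
      Act l q ∧ ¬ IncAt l q ∧ ¬ DecAt l q).filter (p < ·)).card + 1) d := by
  refine siteCounts_insMax h.bounded hp (fun h' => hi h'.1) ?_ ?_ ?_
  · rw [Finset.card_eq_zero.2, zero_add, Finset.card_eq_zero]
    · exact Finset.filter_eq_empty_iff.2 fun q _ h' => hi (h'.1 ▸ h'.2.2)
    · exact Finset.filter_eq_empty_iff.2 fun q _ h' => hd h'.2.2.1
  · rw [← card_filter_le_eq (by simp [ha, hi, hd]; omega)]
    congr 1
    ext q
    simp only [Finset.mem_filter, Finset.mem_range]
    have h1 : p ≤ q → ¬ IncAt l q := fun hq h => hi (h.mono hq)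
    tauto
  · rw [← h.card_dec]
    congr 1
    refine Finset.filter_congr fun q _ => ?_
    refine ⟨fun h => h.2, fun h => ⟨?_, h⟩⟩
    by_contra hqp
    exact hd (h.2.mono (not_le.1 hqp).le)

open scoped Classical in
-- The suffix at `p` decreases, so the increasing sites, all to the left, survive, while the middle
-- sites, also to the left, die. The `+ 1` is the site just after the new maximum.
theorem SiteCounts.insMax_dec {l : List ℕ} {i m d p : ℕ} (h : SiteCounts l i m d)
    (hp : p ≤ l.length) (ha : Act l p) (hd : DecAt l p) :
    SiteCounts (insMax l p) i 0 ((((Finset.range (l.length + 1)).filter fun q =>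
      Act l q ∧ DecAt l q).filter (p < ·)).card + 1) := by
  have hi : ¬ IncAt l p := fun hi => h.disjoint p hp hi hd
  refine siteCounts_insMax h.bounded hp (fun h' => hi h'.1) ?_ ?_ ?_
  · have h0 : ((Finset.range (l.length + 1)).filter fun q => q = p ∧ Act l q ∧ IncAt l q) = ∅ :=
      Finset.filter_eq_empty_iff.2 fun q _ h' => hi (h'.1 ▸ h'.2.2)
    rw [← h.card_inc, h0, Finset.card_empty, add_zero]
    congr 1
    refine Finset.filter_congr fun q _ => ?_
    have h1 : IncAt l q → q ≤ p := fun hq => by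
      by_contra hqp
      exact hi (hq.mono (not_le.1 hqp).le)
    tauto
  · refine Finset.card_eq_zero.2 (Finset.filter_eq_empty_iff.2 fun q _ h' => ?_)
    exact h'.2.2.2 (hd.mono h'.1)
  · rw [← card_filter_le_eq (by simp [ha, hd]; omega)]
    congr 1
    ext q
    simp only [Finset.mem_filter, Finset.mem_range]
    tauto

theorem SiteCounts.descendants_eq {g : ℕ → ℕ → ℕ → ℕ → ℚ} (g_zero : ∀ i m d, g 0 i m d = 1)
    (g_succ : ∀ k i m d, g (k + 1) i m d = ∑ j ∈ Finset.range i, g k 1 (m + j) d +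
      ∑ j ∈ Finset.range m, g k 0 (j + 1) d + ∑ j ∈ Finset.range d, g k i 0 (j + 1))
    (k : ℕ) : ∀ {l : List ℕ} {i m d : ℕ}, SiteCounts l i m d →
      (descendants k l : ℚ) = g k i m d := by
  classical
  induction k with
  | zero => intro l i m d _; simp [descendants, g_zero]
  | succ k ih =>
    intro l i m d h
    set R := Finset.range (l.length + 1)
    have hR : ∀ {p}, p ∈ R → p ≤ l.length := fun hp => by simpa [R, Nat.lt_succ_iff] using hp
    have hsplit : R.filter (Act l) = R.filter (fun q => Act l q ∧ IncAt l q) ∪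
        R.filter (fun q => Act l q ∧ ¬ IncAt l q ∧ ¬ DecAt l q) ∪
        R.filter (fun q => Act l q ∧ DecAt l q) := by
      ext q
      simp only [Finset.mem_filter, Finset.mem_union]
      tauto
    rw [descendants, Nat.cast_sum, g_succ, hsplit, Finset.sum_union, Finset.sum_union]
    · congr 1
      · congr 1
        · rw [← h.card_inc, ← Finset.sum_card_filter_gt _ (fun j => g k 1 (m + j) d)]
          refine Finset.sum_congr rfl fun p hp => ?_
          have hp := Finset.mem_filter.1 hp
          exact ih (h.insMax_inc (hR hp.1) hp.2.1 hp.2.2)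
        · rw [← h.card_mid, ← Finset.sum_card_filter_gt _ (fun j => g k 0 (j + 1) d)]
          refine Finset.sum_congr rfl fun p hp => ?_
          have hp := Finset.mem_filter.1 hp
          exact ih (h.insMax_mid (hR hp.1) hp.2.1 hp.2.2.1 hp.2.2.2)
      · rw [← h.card_dec, ← Finset.sum_card_filter_gt _ (fun j => g k i 0 (j + 1))]
        refine Finset.sum_congr rfl fun p hp => ?_
        have hp := Finset.mem_filter.1 hp
        exact ih (h.insMax_dec (hR hp.1) hp.2.1 hp.2.2)
    · refine Finset.disjoint_left.2 fun q hq hq' => ?_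
      simp only [Finset.mem_filter] at hq hq'
      tauto
    · refine Finset.disjoint_left.2 fun q hq hq' => ?_
      simp only [Finset.mem_filter, Finset.mem_union] at hq hq'
      have := h.disjoint q (hR hq'.1)
      tauto

/-! ### The succession rule for unimodal lists -/

theorem Unimodal.insMax_before {l : List ℕ} {a b : ℕ} (h : Unimodal l a b) :
    Unimodal (insMax l a) a (b + 1) := by
  have hp : a ≤ l.length := by rw [h.length_eq]; omega
  have hd := (h.dec_iff a hp).2 le_rfl
  refine ⟨h.bounded.insMax a, by rw [length_insMax, h.length_eq]; omega, fun q hq => ?_,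
    fun q hq => ?_, fun q hq => ?_⟩ <;> rw [length_insMax] at hq <;>
    rcases le_or_gt q a with hqp | hqp
  · rw [act_insMax_of_le h.bounded hp hqp, h.inc_iff q (by omega)]
    exact ⟨by omega, hd, h.act q (by omega)⟩
  · obtain ⟨q, rfl⟩ : ∃ r, q = r + 1 := ⟨q - 1, by omega⟩
    rw [act_insMax_succ h.bounded hp (by omega)]
    exact h.act q (by omega)
  · rw [incAt_insMax_of_le hp hqp, h.inc_iff q (by omega)]
  · obtain ⟨q, rfl⟩ : ∃ r, q = r + 1 := ⟨q - 1, by omega⟩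
    rw [incAt_insMax_succ h.bounded hp (by omega) (by omega), h.inc_iff a hp]
    omega
  · rw [decAt_insMax_of_le h.bounded hp hqp]
    exact ⟨fun h => h.1.ge, fun h => ⟨by omega, hd⟩⟩
  · obtain ⟨q, rfl⟩ : ∃ r, q = r + 1 := ⟨q - 1, by omega⟩
    rw [decAt_insMax_succ hp (by omega), h.dec_iff q (by omega)]
    omega

theorem Unimodal.insMax_after {l : List ℕ} {a b : ℕ} (h : Unimodal l a b) :
    Unimodal (insMax l (a + 1)) (a + 1) b := by
  have hp : a + 1 ≤ l.length := by rw [h.length_eq]; omega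
  have hd := (h.dec_iff (a + 1) hp).2 (by omega)
  refine ⟨h.bounded.insMax _, by rw [length_insMax, h.length_eq]; omega, fun q hq => ?_,
    fun q hq => ?_, fun q hq => ?_⟩ <;> rw [length_insMax] at hq <;>
    rcases le_or_gt q (a + 1) with hqp | hqp
  · rw [act_insMax_of_le h.bounded hp hqp, h.inc_iff q (by omega)]
    exact ⟨by omega, hd, h.act q (by omega)⟩
  · obtain ⟨q, rfl⟩ : ∃ r, q = r + 1 := ⟨q - 1, by omega⟩
    rw [act_insMax_succ h.bounded hp (by omega)]
    exact h.act q (by omega)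
  · rw [incAt_insMax_of_le hp hqp, h.inc_iff q (by omega)]
    omega
  · obtain ⟨q, rfl⟩ : ∃ r, q = r + 1 := ⟨q - 1, by omega⟩
    rw [incAt_insMax_succ h.bounded hp (by omega) (by omega), h.inc_iff _ hp]
    omega
  · rw [decAt_insMax_of_le h.bounded hp hqp]
    exact ⟨fun h => h.1.ge, fun h => ⟨by omega, hd⟩⟩
  · obtain ⟨q, rfl⟩ : ∃ r, q = r + 1 := ⟨q - 1, by omega⟩
    rw [decAt_insMax_succ hp (by omega), h.dec_iff q (by omega)]
    omega

open scoped Classical in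
-- All sites up to the new maximum die. What remains is the site just after it, the middle sites
-- strictly between `p` and `a`, and the `b + 2` sites from `a` on, whose suffixes decrease.
theorem Unimodal.insMax_left {l : List ℕ} {a b p : ℕ} (h : Unimodal l a b) (hpa : p < a) :
    SiteCounts (insMax l p) 1 (a - 1 - p) (b + 2) := by
  have hp : p ≤ l.length := by rw [h.length_eq]; omega
  have hnd : ¬ DecAt l p := by rw [h.dec_iff p hp]; omega
  have hi : IncAt l p := by rw [h.inc_iff p hp]; omega
  have hlen := h.length_eq
  refine siteCounts_insMax h.bounded hp (fun h' => hnd h'.2) ?_ ?_ ?_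
  · rw [Finset.card_eq_zero.2, zero_add, Finset.card_eq_one]
    · refine ⟨p, Finset.ext fun q => ?_⟩
      simp only [Finset.mem_filter, Finset.mem_range, Finset.mem_singleton]
      exact ⟨fun h => h.2.1, fun h' => ⟨by omega, h', h' ▸ h.act p hp, h' ▸ hi⟩⟩
    · exact Finset.filter_eq_empty_iff.2 fun q _ h' => hnd h'.2.2.1
  · have : a - 1 - p = (Finset.Ioo p a).card := by simp; omega
    rw [this]
    congr 1
    ext q
    simp only [Finset.mem_filter, Finset.mem_range, Finset.mem_Ioo]
    constructor
    · rintro ⟨hq, h1, _, h3, h4⟩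
      rw [h.dec_iff q (by omega)] at h4
      refine ⟨lt_of_le_of_ne h1 fun hpq => h3 ⟨hpq.symm, hpq ▸ hi⟩, by omega⟩
    · rintro ⟨h1, h2⟩
      refine ⟨by omega, h1.le, h.act q (by omega), by omega, ?_⟩
      rw [h.dec_iff q (by omega)]
      omega
  · have : b + 2 = (Finset.Ico a (l.length + 1)).card := by simp; omega
    rw [this]
    congr 1
    ext q
    simp only [Finset.mem_filter, Finset.mem_range, Finset.mem_Ico]
    constructor
    · rintro ⟨hq, h1, _, h3⟩
      rw [h.dec_iff q (by omega)] at h3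
      omega
    · rintro ⟨h1, h2⟩
      refine ⟨by omega, by omega, h.act q (by omega), ?_⟩
      rw [h.dec_iff q (by omega)]
      omega

open scoped Classical in
-- The suffix at `p` decreases, so the sites `0, …, a + 1` with increasing prefix all survive, and
-- those strictly between them and the new maximum die.
theorem Unimodal.insMax_right {l : List ℕ} {a b p : ℕ} (h : Unimodal l a b) (hpa : a + 1 < p)
    (hp : p ≤ l.length) : SiteCounts (insMax l p) (a + 2) 0 (l.length + 1 - p) := by
  have hd : DecAt l p := by rw [h.dec_iff p hp]; omega
  have hni : ¬ IncAt l p := by rw [h.inc_iff p hp]; omega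
  have hlen := h.length_eq
  refine siteCounts_insMax h.bounded hp (fun h' => hni h'.1) ?_ ?_ ?_
  · have h0 : ((Finset.range (l.length + 1)).filter fun q => q = p ∧ Act l q ∧ IncAt l q) = ∅ :=
      Finset.filter_eq_empty_iff.2 fun q _ h' => hni (h'.1 ▸ h'.2.2)
    rw [h0, Finset.card_empty, add_zero]
    have : a + 2 = (Finset.range (a + 2)).card := by simp
    rw [this]
    congr 1
    ext q
    simp only [Finset.mem_filter, Finset.mem_range]
    constructor
    · rintro ⟨hq, h1, h2, _⟩
      rw [h.inc_iff q (by omega)] at h2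
      omega
    · intro hq
      refine ⟨by omega, by omega, ?_, hd, h.act q (by omega)⟩
      rw [h.inc_iff q (by omega)]
      omega
  · refine Finset.card_eq_zero.2 (Finset.filter_eq_empty_iff.2 fun q _ h' => ?_)
    exact h'.2.2.2 (hd.mono h'.1)
  · have : l.length + 1 - p = (Finset.Ico p (l.length + 1)).card := by simp
    rw [this]
    congr 1
    ext q
    simp only [Finset.mem_filter, Finset.mem_range, Finset.mem_Ico]
    exact ⟨fun h => ⟨h.2.1, h.1⟩, fun h' => ⟨h'.2, h'.1, h.act q (by omega), hd.mono h'.1⟩⟩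

theorem Unimodal.descendants_eq {g : ℕ → ℕ → ℕ → ℕ → ℚ} (g_zero : ∀ i m d, g 0 i m d = 1)
    (g_succ : ∀ k i m d, g (k + 1) i m d = ∑ j ∈ Finset.range i, g k 1 (m + j) d +
      ∑ j ∈ Finset.range m, g k 0 (j + 1) d + ∑ j ∈ Finset.range d, g k i 0 (j + 1))
    {u : ℕ → ℕ → ℕ → ℚ} (u_zero : ∀ a b, u 0 a b = 1)
    (u_succ : ∀ k a b, u (k + 1) a b = u k a (b + 1) + u k (a + 1) b +
      ∑ j ∈ Finset.range a, g k 1 j (b + 2) + ∑ j ∈ Finset.range b, g k (a + 2) 0 (j + 1))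
    (k : ℕ) : ∀ {l : List ℕ} {a b : ℕ}, Unimodal l a b → (descendants k l : ℚ) = u k a b := by
  classical
  induction k with
  | zero => intro l a b _; simp [descendants, u_zero]
  | succ k ih =>
    intro l a b h
    have hlen := h.length_eq
    -- Every site is active; they are grouped as `p < a`, `p = a`, `p = a + 1` and `p = a + 2 + j`.
    -- The parameters of the outer groups decrease with the site, hence the reflected sums.
    rw [descendants, Finset.filter_true_of_mem fun q hq => h.act q (by simp at hq; omega),
      Nat.cast_sum, u_succ, show l.length + 1 = a + 2 + b by omega, Finset.sum_range_add,
      Finset.sum_range_add, Finset.sum_range_succ, Finset.sum_range_one,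
      ← Finset.sum_range_reflect (fun j => g k 1 j (b + 2)),
      ← Finset.sum_range_reflect (fun j => g k (a + 2) 0 (j + 1)), add_zero,
      ih h.insMax_before, ih h.insMax_after]
    have h1 : ∑ p ∈ Finset.range a, (descendants k (insMax l p) : ℚ) =
        ∑ j ∈ Finset.range a, g k 1 (a - 1 - j) (b + 2) :=
      Finset.sum_congr rfl fun p hp =>
        SiteCounts.descendants_eq g_zero g_succ k (h.insMax_left (Finset.mem_range.1 hp))
    have h2 : ∑ j ∈ Finset.range b, (descendants k (insMax l (a + 2 + j)) : ℚ) =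
        ∑ j ∈ Finset.range b, g k (a + 2) 0 (b - 1 - j + 1) := by
      refine Finset.sum_congr rfl fun j hj => ?_
      have hj := Finset.mem_range.1 hj
      have := SiteCounts.descendants_eq g_zero g_succ k
        (h.insMax_right (p := a + 2 + j) (by omega) (by omega))
      rw [this]
      congr 1
      omega
    rw [h1, h2]
    ring

/-! ### Closed-form solutions of the functional equations -/

section ClosedForms
variable {R : Type*} [CommRing R]

/-- The generating function of the descendants of a list with site counts `i`, `m`, `d`, where
`c = 1 / (1 - x)` and `w = (1 - x) / (1 - 2 * x)`. -/
def countsSeries (c w : R) (i m d : ℕ) : R :=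
  c ^ (d + i + m) + c ^ d * (d * ((c - 1) * (c ^ i - 1) - i * (c - 1) ^ 2) - i * c) + i * c * w ^ d

/-- For `D = 1 / (1 - x * (r + s))`, the solution of `F a b = r ^ a * s ^ b + x * (F (a + 1) b +
F a (b + 1))`. -/
def latticeSeries (r s D : R) (a b : ℕ) : R := r ^ a * s ^ b * D

/-- The analogue of `latticeSeries` with inhomogeneous term `a * r ^ a * s ^ b`. -/
def latticeSeriesLeft (x r s D : R) (a b : ℕ) : R := r ^ a * s ^ b * (a * D + x * r * D ^ 2)

/-- The analogue of `latticeSeries` with inhomogeneous term `b * r ^ a * s ^ b`. -/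
def latticeSeriesRight (x r s D : R) (a b : ℕ) : R := r ^ a * s ^ b * (b * D + x * s * D ^ 2)

/-- The analogue of `latticeSeries` with inhomogeneous term `a * b * r ^ a * s ^ b`. -/
def latticeSeriesBoth (x r s D : R) (a b : ℕ) : R :=
  r ^ a * s ^ b * (a * b * D + (a * (x * s) + b * (x * r)) * D ^ 2 + 2 * (x * r) * (x * s) * D ^ 3)

/-- The function `r ^ a * s ^ b` is an eigenvector, with eigenvalue `r + s`, of the sum of the two
shifts, so the iteration is a geometric series. The three variants arise formally by applying `r
∂/∂r`, `s ∂/∂s`, or both, using `∂D/∂r = ∂D/∂s = x * D ^ 2`. -/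
theorem latticeSeries_eq {x r s D : R} (hD : (1 - x * (r + s)) * D = 1) (a b : ℕ) :
    latticeSeries r s D a b = r ^ a * s ^ b +
      x * (latticeSeries r s D a (b + 1) + latticeSeries r s D (a + 1) b) := by
  simp only [latticeSeries]
  linear_combination r ^ a * s ^ b * hD

theorem latticeSeriesLeft_eq {x r s D : R} (hD : (1 - x * (r + s)) * D = 1) (a b : ℕ) :
    latticeSeriesLeft x r s D a b = a * (r ^ a * s ^ b) +
      x * (latticeSeriesLeft x r s D a (b + 1) + latticeSeriesLeft x r s D (a + 1) b) := by
  simp only [latticeSeriesLeft]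
  push_cast
  linear_combination r ^ a * s ^ b * (a + x * r * D) * hD

theorem latticeSeriesRight_eq {x r s D : R} (hD : (1 - x * (r + s)) * D = 1) (a b : ℕ) :
    latticeSeriesRight x r s D a b = b * (r ^ a * s ^ b) +
      x * (latticeSeriesRight x r s D a (b + 1) + latticeSeriesRight x r s D (a + 1) b) := by
  simp only [latticeSeriesRight]
  push_cast
  linear_combination r ^ a * s ^ b * (b + x * s * D) * hD

theorem latticeSeriesBoth_eq {x r s D : R} (hD : (1 - x * (r + s)) * D = 1) (a b : ℕ) :
    latticeSeriesBoth x r s D a b = a * b * (r ^ a * s ^ b) +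
      x * (latticeSeriesBoth x r s D a (b + 1) + latticeSeriesBoth x r s D (a + 1) b) := by
  simp only [latticeSeriesBoth]
  push_cast
  linear_combination r ^ a * s ^ b *
    (a * b + (a * (x * s) + b * (x * r)) * D + 2 * (x * r) * (x * s) * D ^ 2) * hD

/-- The generating function of the descendants of a unimodal list, where `p`, `q`, `t` are the
inverses of `1 - x * (c + c)`, `1 - x * (1 + c)` and `1 - x * (1 + w)`. -/
def unimodalSeries (x c w p q t : R) (a b : ℕ) : R :=
  c ^ 2 * latticeSeries c c p a b + (c - 1) * c ^ 2 * latticeSeriesRight x c c p a b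
    - (1 + c ^ 2) * latticeSeries 1 c q a b
    - (1 + (c - 1) * c ^ 2) * latticeSeriesLeft x 1 c q a b
    - ((c - 1) + 2 * (c - 1) ^ 2) * latticeSeriesRight x 1 c q a b
    - (c - 1) ^ 2 * latticeSeriesBoth x 1 c q a b
    + 2 * latticeSeries 1 w t a b + (1 + (c - 1) * w ^ 2) * latticeSeriesLeft x 1 w t a b

/-- The sum telescopes, since `x * c = c - 1`. -/
theorem mul_sum_pow {x c : R} (hc : (1 - x) * c = 1) (n : ℕ) : x * ∑ j ∈ Finset.range n, c ^ (j + 1) = c ^ n - 1 := by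
  induction n with
  | zero => simp
  | succ n ih => rw [Finset.sum_range_succ, mul_add, ih]; linear_combination -c ^ n * hc

/-- Summation by parts leaves a geometric sum of powers of `c`; the factor `c - 1`, present wherever
this is applied, clears it. -/
theorem mul_sum_mul_pow {x c : R} (hc : (1 - x) * c = 1)
    (n : ℕ) :
    (c - 1) * (x * ∑ j ∈ Finset.range n, ((j : R) + 1) * c ^ (j + 1)) =
      (c - 1) * (n * c ^ n) - (c ^ n - 1) := by
  induction n with
  | zero => simp
  | succ n ih =>
    rw [Finset.sum_range_succ, mul_add, mul_add, ih]; push_cast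
    linear_combination -(c - 1) * (n + 1) * c ^ n * hc

theorem mul_sum_pow' {x w : R} (hw : (1 - 2 * x) * w = 1 - x)
    (n : ℕ) : x * ∑ j ∈ Finset.range n, w ^ (j + 1) = (1 - x) * (w ^ n - 1) := by
  induction n with
  | zero => simp
  | succ n ih => rw [Finset.sum_range_succ, mul_add, ih]; linear_combination -w ^ n * hw

theorem mul_sum_countsSeries_dec {x c w : R} (hc : (1 - x) * c = 1) (hw : (1 - 2 * x) * w = 1 - x)
    (i d : ℕ) :
    x * ∑ j ∈ Finset.range d, countsSeries c w i 0 (j + 1) =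
      countsSeries c w i 0 d - 1 - c ^ d * (c ^ i - 1) - i * (c - 1) * (w ^ d - c ^ d) := by
  have : ∀ j : ℕ, countsSeries c w i 0 (j + 1) = (c ^ i - i * c) * c ^ (j + 1)
      + ((c ^ i - 1) - i * (c - 1)) * ((c - 1) * ((j + 1) * c ^ (j + 1)))
      + i * c * w ^ (j + 1) := fun j => by
    rw [countsSeries]; push_cast; ring
  simp_rw [this, Finset.sum_add_distrib, ← Finset.mul_sum]
  have h1 := mul_sum_pow hc d
  have h2 := mul_sum_mul_pow hc d
  have h3 := mul_sum_pow' hw d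
  rw [countsSeries]
  linear_combination (c ^ i - i * c) * h1 + ((c ^ i - 1) - i * (c - 1)) * h2 + i * c * h3
    + i * (w ^ d - 1) * hc

theorem mul_sum_countsSeries_inc {x c w : R} (hc : (1 - x) * c = 1)
    (i m d : ℕ) :
    x * ∑ j ∈ Finset.range i, countsSeries c w 1 (m + j) d =
      c ^ (d + m) * (c ^ i - 1) + i * (c - 1) * (w ^ d - c ^ d) := by
  have : ∀ j : ℕ, countsSeries c w 1 (m + j) d = c ^ (d + m) * c ^ (j + 1)
      + (c * w ^ d - c * c ^ d) := fun j => by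
    rw [countsSeries]; push_cast; ring
  simp_rw [this, Finset.sum_add_distrib, ← Finset.mul_sum]
  have h1 := mul_sum_pow hc i
  simp only [Finset.sum_const, Finset.card_range, nsmul_eq_mul]
  linear_combination c ^ (d + m) * h1 - i * (w ^ d - c ^ d) * hc

theorem countsSeries_eq {x c w : R} (hc : (1 - x) * c = 1) (hw : (1 - 2 * x) * w = 1 - x)
    (i m d : ℕ) : countsSeries c w i m d =
    1 + x * (∑ j ∈ Finset.range i, countsSeries c w 1 (m + j) d +
      ∑ j ∈ Finset.range m, countsSeries c w 0 (j + 1) d +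
      ∑ j ∈ Finset.range d, countsSeries c w i 0 (j + 1)) := by
  have : ∀ j : ℕ, countsSeries c w 0 (j + 1) d = c ^ d * c ^ (j + 1) := fun j => by
    rw [countsSeries]; push_cast; ring
  simp_rw [mul_add, mul_sum_countsSeries_inc hc, mul_sum_countsSeries_dec hc hw, this,
    ← Finset.mul_sum]
  have h1 := mul_sum_pow hc m
  simp only [countsSeries]
  linear_combination -c ^ d * h1

/-- The children that are not unimodal contribute combinations of `r ^ a * s ^ b`, possibly times
`a`, `b` or `a * b`, with `(r, s)` among `(c, c)`, `(1, c)`, `(1, w)`. By linearity the matching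
lattice solutions are added up. -/
theorem unimodalSeries_eq {x c w : R} (hc : (1 - x) * c = 1) (hw : (1 - 2 * x) * w = 1 - x)
    {p q t : R} (hp : (1 - x * (c + c)) * p = 1) (hq : (1 - x * (1 + c)) * q = 1)
    (ht : (1 - x * (1 + w)) * t = 1) (a b : ℕ) : unimodalSeries x c w p q t a b =
    1 + x * (unimodalSeries x c w p q t a (b + 1) + unimodalSeries x c w p q t (a + 1) b +
      ∑ j ∈ Finset.range a, countsSeries c w 1 j (b + 2) +
      ∑ j ∈ Finset.range b, countsSeries c w (a + 2) 0 (j + 1)) := by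
  have h := mul_sum_countsSeries_inc (w := w) hc a 0 (b + 2)
  simp only [zero_add] at h
  simp_rw [mul_add, h, mul_sum_countsSeries_dec hc hw]
  simp only [unimodalSeries, countsSeries]
  push_cast
  linear_combination c ^ 2 * latticeSeries_eq hp a b
    + (c - 1) * c ^ 2 * latticeSeriesRight_eq hp a b
    - (1 + c ^ 2) * latticeSeries_eq hq a b
    - (1 + (c - 1) * c ^ 2) * latticeSeriesLeft_eq hq a b
    - ((c - 1) + 2 * (c - 1) ^ 2) * latticeSeriesRight_eq hq a b
    - (c - 1) ^ 2 * latticeSeriesBoth_eq hq a b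
    + 2 * latticeSeries_eq ht a b + (1 + (c - 1) * w ^ 2) * latticeSeriesLeft_eq ht a b
end ClosedForms

theorem one_add_mul_unimodalSeries_eq_div {K : Type*} [Field K] {x : K} (h1 : 1 - x ≠ 0) (h2 : 1 - 2 * x ≠ 0)
    (h3 : 1 - 3 * x ≠ 0) (h5 : 1 - 3 * x + x ^ 2 ≠ 0) :
    1 + x * unimodalSeries x (1 / (1 - x)) ((1 - x) / (1 - 2 * x)) ((1 - x) / (1 - 3 * x))
      ((1 - x) / (1 - 3 * x + x ^ 2)) ((1 - 2 * x) / ((1 - x) * (1 - 3 * x))) 0 0 =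
    (1 - 16 * x + 109 * x ^ 2 - 411 * x ^ 3 + 936 * x ^ 4 - 1323 * x ^ 5 + 1154 * x ^ 6
      - 602 * x ^ 7 + 178 * x ^ 8 - 28 * x ^ 9) /
      ((1 - x) ^ 2 * (1 - 3 * x) ^ 2 * (1 - 3 * x + x ^ 2) ^ 3) := by
  simp only [unimodalSeries, latticeSeries, latticeSeriesLeft, latticeSeriesRight,
    latticeSeriesBoth, pow_zero, Nat.cast_zero]
  have h2' : 1 - x * 2 ≠ 0 := by rwa [mul_comm]
  have h3' : 1 - x * 3 ≠ 0 := by rwa [mul_comm x]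
  have h5' : 1 - x * 3 + x ^ 2 ≠ 0 := by rwa [mul_comm x]
  field_simp
  ring

/-! ### Each avoiding list is generated exactly once -/

open scoped Classical in
/-- The lists of `0, …, n - 1` that avoid 2143 and 4312, generated by inserting maxima. -/
noncomputable def avoidLists : ℕ → Finset (List ℕ)
  | 0 => {[]}
  | n + 1 => (avoidLists n).biUnion fun l =>
      ((Finset.range (l.length + 1)).filter (Act l)).image (insMax l)

theorem bounded_of_perm_range {l : List ℕ} {n : ℕ} (h : l ~ List.range n) : Bounded l := by
  intro x hx
  rw [h.length_eq, List.length_range]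
  exact List.mem_range.1 (h.mem_iff.1 hx)

theorem insMax_perm (l : List ℕ) (p : ℕ) : insMax l p ~ l.length :: l := by
  refine List.perm_middle.trans ?_
  rw [List.take_append_drop]

theorem mem_avoidLists {n : ℕ} {l : List ℕ} :
    l ∈ avoidLists n ↔ l ~ List.range n ∧ ListAvoids l := by
  induction n generalizing l with
  | zero =>
    simp only [avoidLists, Finset.mem_singleton, List.range_zero, List.perm_nil]
    refine ⟨?_, fun h => h.1⟩
    rintro rfl
    exact ⟨rfl, fun a b c d _ _ _ => by simp⟩
  | succ n ih =>
    have hrange : n :: List.range n ~ List.range (n + 1) := by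
      rw [List.range_succ]
      exact (List.perm_append_singleton n _).symm
    simp only [avoidLists, Finset.mem_biUnion, Finset.mem_image, Finset.mem_filter]
    constructor
    · rintro ⟨l, hl, p, hp, rfl⟩
      rw [ih] at hl
      refine ⟨(insMax_perm l p).trans ?_,
        (listAvoids_insMax_iff (bounded_of_perm_range hl.1)).2 ⟨hl.2, hp.2⟩⟩
      rw [hl.1.length_eq, List.length_range]
      exact (hl.1.cons n).trans hrange
    · rintro ⟨hl, hav⟩
      obtain ⟨A, B, rfl⟩ := List.append_of_mem (hl.mem_iff.2 (List.mem_range.2 n.lt_succ_self))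
      have hAB : A ++ B ~ List.range n :=
        (List.perm_cons n).1 (List.perm_middle.symm.trans (hl.trans hrange.symm))
      have hlen : (A ++ B).length = n := by rw [hAB.length_eq, List.length_range]
      have hins : insMax (A ++ B) A.length = A ++ n :: B := by
        rw [insMax, hlen, List.take_left, List.drop_left]
      rw [← hins, listAvoids_insMax_iff (bounded_of_perm_range hAB)] at hav
      refine ⟨A ++ B, ih.2 ⟨hAB, hav.1⟩, A.length, ⟨?_, hav.2⟩, hins⟩
      rw [Finset.mem_range, List.length_append]
      omega

/-- Erasing the maximum recovers the parent; with `insMax_injOn`, where its index recovers the site,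
this rules out double counting. -/
theorem insMax_erase {l : List ℕ} (hl : Bounded l) (p : ℕ) : (insMax l p).erase l.length = l := by
  rw [insMax, List.erase_append_right _ fun h => (hl _ (List.mem_of_mem_take h)).false,
    List.erase_cons_head, List.take_append_drop]

theorem insMax_injOn {l : List ℕ} (hl : Bounded l) :
    Set.InjOn (insMax l) {p | p ≤ l.length} := by
  have key : ∀ p ≤ l.length, (insMax l p).idxOf l.length = p := fun p hp => by
    rw [insMax, List.idxOf_append_of_notMem fun h => (hl _ (List.mem_of_mem_take h)).false,
      List.idxOf_cons_self, List.length_take, min_eq_left hp, add_zero]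
  intro p hp q hq h
  rw [← key p hp, h, key q hq]

theorem sum_descendants_avoidLists_succ (k n : ℕ) :
    ∑ l ∈ avoidLists (n + 1), descendants k l = ∑ l ∈ avoidLists n, descendants (k + 1) l := by
  classical
  rw [avoidLists, Finset.sum_biUnion]
  · refine Finset.sum_congr rfl fun l hl => ?_
    rw [descendants, Finset.sum_image]
    intro p hp q hq h
    have hb := bounded_of_perm_range (mem_avoidLists.1 hl).1
    simp only [Finset.coe_filter, Finset.mem_range, Set.mem_ofPred_eq] at hp hq
    exact insMax_injOn hb (show p ≤ l.length by omega) (show q ≤ l.length by omega) h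
  · intro l hl l' hl' hne
    refine Finset.disjoint_left.2 fun x hx hx' => hne ?_
    obtain ⟨p, _, rfl⟩ := Finset.mem_image.1 hx
    obtain ⟨p', _, h⟩ := Finset.mem_image.1 hx'
    have h1 := (mem_avoidLists.1 hl).1
    have h2 := (mem_avoidLists.1 hl').1
    have hlen : l'.length = l.length := by rw [h1.length_eq, h2.length_eq]
    rw [← insMax_erase (bounded_of_perm_range h1) p, ← h, ← hlen,
      insMax_erase (bounded_of_perm_range h2)]

theorem card_avoidLists (n : ℕ) : (avoidLists n).card = descendants n [] := by
  have : ∀ k n, ∑ l ∈ avoidLists n, descendants k l = descendants (k + n) [] := by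
    intro k n
    induction n generalizing k with
    | zero => simp [avoidLists]
    | succ n ih => rw [sum_descendants_avoidLists_succ, ih]; congr 1; omega
  simpa [descendants] using this 0 n

/-! ### From permutations to lists -/

theorem sublist_ofFn_iff {α : Type*} {n : ℕ} {s : List α} {g : Fin n → α} :
    s <+ List.ofFn g ↔ ∃ f : Fin s.length ↪o Fin n, ∀ i, s.get i = g (f i) := by
  rw [List.sublist_iff_exists_fin_orderEmbedding_get_eq]
  constructor
  · rintro ⟨f, hf⟩
    refine ⟨f.trans (Fin.castOrderIso List.length_ofFn).toOrderEmbedding, fun i => ?_⟩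
    rw [hf i, List.get_ofFn]
    rfl
  · rintro ⟨f, hf⟩
    refine ⟨f.trans (Fin.castOrderIso List.length_ofFn.symm).toOrderEmbedding, fun i => ?_⟩
    rw [hf i, List.get_ofFn]
    rfl

/-- The one-line notation of a permutation. -/
def oneLine {n : ℕ} (π : Equiv.Perm (Fin n)) : List ℕ := List.ofFn fun i => (π i : ℕ)

theorem permContains_2143_iff {n : ℕ} (π : Equiv.Perm (Fin n)) :
    PermContains π perm2143 ↔
      ∃ a b c d, a < b ∧ b < c ∧ c < d ∧ [b, a, d, c] <+ oneLine π := by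
  constructor
  · rintro ⟨f, hf⟩
    -- The witnesses are listed by increasing value, so the positions are those of the inverse of
    -- 2143.
    refine ⟨π (f 1), π (f 0), π (f 3), π (f 2), (hf 1 0).1 (by decide), (hf 0 3).1 (by decide),
      (hf 3 2).1 (by decide), sublist_ofFn_iff.2 ⟨f, fun i => ?_⟩⟩
    fin_cases i <;> rfl
  · rintro ⟨a, b, c, d, hab, hbc, hcd, h⟩
    obtain ⟨f, hf⟩ := sublist_ofFn_iff.1 h
    have hval : ∀ i : Fin 4, (π (f i) : ℕ) = ![b, a, d, c] i := fun i =>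
      (hf i).symm.trans (by fin_cases i <;> rfl)
    refine ⟨f, fun i j => ?_⟩
    rw [Fin.lt_def (a := π _), hval, hval]
    fin_cases i <;> fin_cases j <;> simp [perm2143] <;> omega

theorem permContains_4312_iff {n : ℕ} (π : Equiv.Perm (Fin n)) :
    PermContains π perm4312 ↔
      ∃ a b c d, a < b ∧ b < c ∧ c < d ∧ [d, c, a, b] <+ oneLine π := by
  constructor
  · rintro ⟨f, hf⟩
    refine ⟨π (f 2), π (f 3), π (f 1), π (f 0), (hf 2 3).1 (by decide), (hf 3 1).1 (by decide),
      (hf 1 0).1 (by decide), sublist_ofFn_iff.2 ⟨f, fun i => ?_⟩⟩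
    fin_cases i <;> rfl
  · rintro ⟨a, b, c, d, hab, hbc, hcd, h⟩
    obtain ⟨f, hf⟩ := sublist_ofFn_iff.1 h
    have hval : ∀ i : Fin 4, (π (f i) : ℕ) = ![d, c, a, b] i := fun i =>
      (hf i).symm.trans (by fin_cases i <;> rfl)
    refine ⟨f, fun i j => ?_⟩
    rw [Fin.lt_def (a := π _), hval, hval]
    fin_cases i <;> fin_cases j <;> simp [perm4312] <;> omega

theorem mem_av_iff {n : ℕ} (π : Equiv.Perm (Fin n)) :
    (⟨n, π⟩ : Σ n : ℕ, Equiv.Perm (Fin n)) ∈ Av {⟨4, perm2143⟩, ⟨4, perm4312⟩} ↔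
      ListAvoids (oneLine π) := by
  simp only [Av, Set.mem_ofPred_eq, Set.mem_insert_iff, Set.mem_singleton_iff, forall_eq_or_imp,
    forall_eq, permContains_2143_iff, permContains_4312_iff, ListAvoids]
  constructor
  · exact fun h a b c d h1 h2 h3 => ⟨fun h' => h.1 ⟨a, b, c, d, h1, h2, h3, h'⟩,
      fun h' => h.2 ⟨a, b, c, d, h1, h2, h3, h'⟩⟩
  · refine fun h => ⟨?_, ?_⟩
    · rintro ⟨a, b, c, d, h1, h2, h3, h'⟩
      exact (h a b c d h1 h2 h3).1 h'
    · rintro ⟨a, b, c, d, h1, h2, h3, h'⟩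
      exact (h a b c d h1 h2 h3).2 h'

theorem oneLine_perm_range {n : ℕ} (π : Equiv.Perm (Fin n)) : oneLine π ~ List.range n := by
  refine (List.perm_ext_iff_of_nodup (List.nodup_ofFn.2 (Fin.val_injective.comp π.injective))
    List.nodup_range).2 fun x => ?_
  rw [List.mem_range]
  refine List.mem_ofFn.trans ?_
  constructor
  · rintro ⟨i, rfl⟩
    exact (π i).2
  · exact fun hx => ⟨π.symm ⟨x, hx⟩, by simp⟩

theorem exists_oneLine_eq {n : ℕ} {l : List ℕ} (h : l ~ List.range n) :
    ∃ π : Equiv.Perm (Fin n), oneLine π = l := by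
  obtain rfl : l.length = n := by rw [h.length_eq, List.length_range]
  have hb := bounded_of_perm_range h
  have hinj : Function.Injective fun i : Fin l.length => (⟨l.get i, hb _ (l.get_mem i)⟩ : Fin _) :=
    fun i j hij => (List.nodup_iff_injective_get.1 (h.nodup_iff.2 List.nodup_range))
      (congrArg Fin.val hij)
  exact ⟨Equiv.ofBijective _ (Finite.injective_iff_bijective.1 hinj), List.ofFn_get l⟩

theorem card_av (n : ℕ) :
    Nat.card {π : Equiv.Perm (Fin n) // (⟨n, π⟩ : Σ n : ℕ, Equiv.Perm (Fin n)) ∈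
      Av {⟨4, perm2143⟩, ⟨4, perm4312⟩}} = descendants n [] := by
  rw [← card_avoidLists, ← Nat.card_eq_finsetCard]
  refine Nat.card_eq_of_bijective (fun π => ⟨oneLine π.1,
    mem_avoidLists.2 ⟨oneLine_perm_range π.1, (mem_av_iff π.1).1 π.2⟩⟩) ⟨fun π ρ h => ?_, ?_⟩
  · refine Subtype.ext (Equiv.ext fun i => Fin.val_injective ?_)
    exact congrFun (List.ofFn_injective (congrArg Subtype.val h)) i
  · rintro ⟨l, hl⟩
    have hl' := mem_avoidLists.1 hl
    obtain ⟨π, rfl⟩ := exists_oneLine_eq hl'.1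
    exact ⟨⟨π, (mem_av_iff π).2 hl'.2⟩, rfl⟩

/-! ### The root of the tree and the final evaluation -/

theorem unimodal_singleton : Unimodal [0] 0 0 := by
  have h2 : ∀ q, q ≤ [0].length → q = 0 ∨ q = 1 := fun q hq => by simp at hq; omega
  refine ⟨fun x hx => by simpa using hx, rfl, fun q hq => ?_, fun q hq => ?_, fun q hq => ?_⟩ <;>
    rcases h2 q hq with rfl | rfl
  · simp [Act, ActiveSplit, List.sublist_cons_iff]
  · simp [Act, ActiveSplit]
  · simp [IncAt]
  · simp [IncAt]
  · simp [DecAt]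
  · simp [DecAt]

theorem descendants_succ_nil (n : ℕ) : descendants (n + 1) [] = descendants n [0] := by
  classical
  rw [descendants, Finset.filter_true_of_mem]
  · simp [insMax]
  · simp [Act, ActiveSplit]

/-- The identity is checked in the fraction field. The equations for `c`, `p` and `q` force the
other denominators to be nonzero, so only `1 - 2 * x` needs a hypothesis. -/
theorem closed_form_mul {R : Type*} [CommRing R] [IsDomain R] {x c w p q t : R}
    (hx : 1 - 2 * x ≠ 0) (hc : (1 - x) * c = 1) (hw : (1 - 2 * x) * w = 1 - x)
    (hp : (1 - x * (c + c)) * p = 1) (hq : (1 - x * (1 + c)) * q = 1)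
    (ht : (1 - x * (1 + w)) * t = 1) :
    (1 + x * unimodalSeries x c w p q t 0 0) *
      ((1 - x) ^ 2 * (1 - 3 * x) ^ 2 * (1 - 3 * x + x ^ 2) ^ 3) =
    1 - 16 * x + 109 * x ^ 2 - 411 * x ^ 3 + 936 * x ^ 4 - 1323 * x ^ 5 + 1154 * x ^ 6
      - 602 * x ^ 7 + 178 * x ^ 8 - 28 * x ^ 9 := by
  have hp' : (1 - 3 * x) * p = 1 - x := by linear_combination (1 - x) * hp + 2 * x * p * hc
  have hq' : (1 - 3 * x + x ^ 2) * q = 1 - x := by linear_combination (1 - x) * hq + x * q * hc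
  have ht' : (1 - x) * (1 - 3 * x) * t = 1 - 2 * x := by
    linear_combination (1 - 2 * x) * ht + x * t * hw
  have h1 : 1 - x ≠ 0 := left_ne_zero_of_mul (hc ▸ one_ne_zero)
  have h3 : 1 - 3 * x ≠ 0 := left_ne_zero_of_mul (hp' ▸ h1)
  have h5 : 1 - 3 * x + x ^ 2 ≠ 0 := left_ne_zero_of_mul (hq' ▸ h1)
  let φ := algebraMap R (FractionRing R)
  have hφ : Function.Injective φ := IsFractionRing.injective R (FractionRing R)
  have hne : ∀ {y : R}, y ≠ 0 → φ y ≠ 0 := fun h => (map_ne_zero_iff φ hφ).2 h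
  apply hφ
  have n1 := hne h1
  have n2 := hne hx
  have n3 := hne h3
  have n5 := hne h5
  replace hc := congrArg φ hc
  replace hw := congrArg φ hw
  replace hp' := congrArg φ hp'
  replace hq' := congrArg φ hq'
  replace ht' := congrArg φ ht'
  simp only [map_mul, map_add, map_sub, map_pow, map_one, map_ofNat, unimodalSeries,
    latticeSeries, latticeSeriesLeft, latticeSeriesRight, latticeSeriesBoth, map_natCast]
    at n1 n2 n3 n5 hc hw hp' hq' ht' ⊢
  rw [mul_comm] at hc hw hp' hq' ht'
  have key := one_add_mul_unimodalSeries_eq_div n1 n2 n3 n5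
  rw [eq_div_iff (by positivity)] at key
  rw [eq_div_of_mul_eq n1 hc, eq_div_of_mul_eq n2 hw, eq_div_of_mul_eq n3 hp',
    eq_div_of_mul_eq n5 hq', eq_div_of_mul_eq (mul_ne_zero n1 n3) ht']
  simpa only [unimodalSeries,
    latticeSeries, latticeSeriesLeft, latticeSeriesRight, latticeSeriesBoth] using key

theorem mainTheorem4 :
    permGenFun (Av {⟨4, perm2143⟩, ⟨4, perm4312⟩}) =
      (1 - 16 * PowerSeries.X + 109 * PowerSeries.X ^ 2 - 411 * PowerSeries.X ^ 3
          + 936 * PowerSeries.X ^ 4 - 1323 * PowerSeries.X ^ 5 + 1154 * PowerSeries.X ^ 6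
          - 602 * PowerSeries.X ^ 7 + 178 * PowerSeries.X ^ 8
          - 28 * PowerSeries.X ^ 9 : PowerSeries ℚ) *
        ((1 - PowerSeries.X) ^ 2 * (1 - 3 * PowerSeries.X) ^ 2
          * (1 - 3 * PowerSeries.X + PowerSeries.X ^ 2) ^ 3 : PowerSeries ℚ)⁻¹ := by
  have hinv : ∀ s : PowerSeries ℚ, (1 - PowerSeries.X * s) * (1 - PowerSeries.X * s)⁻¹ = 1 :=
    fun s => PowerSeries.mul_inv_cancel _ (by simp)
  obtain ⟨c, hc⟩ : ∃ c : PowerSeries ℚ, (1 - PowerSeries.X) * c = 1 := by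
    have := hinv 1
    rw [mul_one] at this
    exact ⟨_, this⟩
  obtain ⟨w, hw⟩ : ∃ w : PowerSeries ℚ, (1 - 2 * PowerSeries.X) * w = 1 - PowerSeries.X :=
    ⟨(1 - PowerSeries.X * 2)⁻¹ * (1 - PowerSeries.X), by
      rw [mul_comm 2, ← mul_assoc, hinv, one_mul]⟩
  obtain ⟨p, hp⟩ : ∃ p, (1 - PowerSeries.X * (c + c)) * p = 1 := ⟨_, hinv _⟩
  obtain ⟨q, hq⟩ : ∃ q, (1 - PowerSeries.X * (1 + c)) * q = 1 := ⟨_, hinv _⟩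
  obtain ⟨t, ht⟩ : ∃ t, (1 - PowerSeries.X * (1 + w)) * t = 1 := ⟨_, hinv _⟩
  have h2 : (1 - 2 * PowerSeries.X : PowerSeries ℚ) ≠ 0 := fun h => by
    simpa using congrArg PowerSeries.constantCoeff h
  rw [PowerSeries.eq_mul_inv_iff_mul_eq (by simp), ← closed_form_mul h2 hc hw hp hq ht]
  congr 1
  have hG := countsSeries_eq hc hw
  have hU := unimodalSeries_eq hc hw hp hq ht
  -- Taking the coefficient of `X ^ (k + 1)` in the functional equations gives exactly the
  -- succession rules, and the constant coefficients are 1.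
  have key := fun n => Unimodal.descendants_eq
    (g := fun k i m d => PowerSeries.coeff k (countsSeries c w i m d))
    (u := fun k a b => PowerSeries.coeff k (unimodalSeries PowerSeries.X c w p q t a b))
    (fun i m d => by rw [hG]; simp)
    (fun k i m d => by
      rw [hG, map_add, PowerSeries.coeff_succ_X_mul]
      simp [PowerSeries.coeff_one])
    (fun a b => by rw [hU]; simp)
    (fun k a b => by
      rw [hU, map_add, PowerSeries.coeff_succ_X_mul]
      simp [PowerSeries.coeff_one])
    n unimodal_singleton
  ext n
  rw [permGenFun, PowerSeries.coeff_mk, card_av]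
  cases n with
  | zero => simp [descendants]
  | succ n =>
    rw [descendants_succ_nil, key, map_add, PowerSeries.coeff_succ_X_mul]
    simp [PowerSeries.coeff_one]
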